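/- **Theorem (Robustness in $t$).** Let $A\subset\mathbb{R}^2$ be a bounded contractible domain, let $E>0$, $-1<\nu<1$, let $\kappa=k_s\mu>0$, and let $\mathbb{A}$ be the compliance tensor $\mathbb{A}\boldsymbol S=\frac{12}{E}\left[(1+\nu)\boldsymbol S-\nu\,(\operatorname{tr}\boldsymbol S)\,\mathbb{1}\right]$. Put $Y(A)=L^2(A)\times[L^2(A)]^2$ and $Z(A)=H(\mathrm{sym},\mathrm{Div},A)\times H(\mathrm{div},A)$, where $H(\mathrm{div},A)$ is the space of $\boldsymbol v\in[L^2(A)]^2$ with weak divergence $\operatorname{div}\boldsymbol v\in L^2(A)$, $H(\mathrm{sym},\mathrm{Div},A)$ is the space of symmetric matrix fields with rows in $H(\mathrm{div},A)$, and $\operatorname{Div}$ is the row-wise divergence. For a thickness $t>0$ and a load $g\in L^2(A)$ consider the four-field problem: find $\{w,\boldsymbol\phi\}\in Y(A)$ and $\{\boldsymbol M,\boldsymbol q\}\in Z(A)$ such that $$\int_A \langle\delta\boldsymbol M,\mathbb{A}\boldsymbol M\rangle+\frac{t^2}{\kappa}\langle\delta\boldsymbol q,\boldsymbol q\rangle+\langle\operatorname{Div}\delta\boldsymbol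 M,\boldsymbol\phi\rangle-(\operatorname{div}\delta\boldsymbol q)\,w-\langle\delta\boldsymbol q,\boldsymbol\phi\rangle\,\mathrm dA=0\qquad\forall\,\{\delta\boldsymbol M,\delta\boldsymbol q\}\in Z(A),$$ $$\int_A \langle\delta\boldsymbol\phi,\operatorname{Div}\boldsymbol M\rangle-\delta w\,(\operatorname{div}\boldsymbol q)-\langle\delta\boldsymbol\phi,\boldsymbol q\rangle\,\mathrm dA=-\int_A\delta w\,g\,\mathrm dA\qquad\forall\,\{\delta w,\delta\boldsymbol\phi\}\in Y(A).$$ Let $\|\{w,\boldsymbol\phi\}\|_Y^2=\|w\|_{L^2}^2+\|\boldsymbol\phi\|_{L^2}^2$, and let $\|g\|_{Y'}$ be the norm of the functional $\{\delta w,\delta\boldsymbol\phi\}\mapsto\int_A\delta w\,g\,\mathrm dA$ in the dual space $Y'$ of $Y(A)$. Then: 1. For every $t>0$ the problem is well-posed in $X(A)=Y(A)\times Z(A)$: for every $g\in L^2(A)$ it has exactly one solution, and there is a constant $C$ (which may depend on $t$) such that for all $g$ the solution satisfies $$\|\{w,\boldsymbol\phi\}\|_Y+\left(\|\boldsymbol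 M\|_{L^2}^2+\|\operatorname{Div}\boldsymbol M\|_{L^2}^2+\|\boldsymbol q\|_{L^2}^2+\|\operatorname{div}\boldsymbol q\|_{L^2}^2\right)^{1/2}\le C\,\|g\|_{Y'}.$$ 2. There is a constant $c>0$, depending only on $A$, $\mathbb{A}$ and $\kappa$, such that for all $t\in(0,1]$ and all $g\in L^2(A)$ the solution satisfies the stability estimate $$\|\{w,\boldsymbol\phi\}\|_Y+\|\{\boldsymbol M,\boldsymbol q\}\|_{Z_t}\le c\,\|g\|_{Y'},$$ where $$\|\{\boldsymbol M,\boldsymbol q\}\|_{Z_t}^2=\|\boldsymbol M\|_{L^2}^2+\|\operatorname{Div}\boldsymbol M-\boldsymbol q\|_{L^2}^2+t^2\|\boldsymbol q\|_{L^2}^2+\|\operatorname{div}\boldsymbol q\|_{L^2}^2.$$ -/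

import Mathlib

open MeasureTheory
open scoped ContDiff

namespace Plate

noncomputable section

/-- The plane `ℝ²` with its Euclidean structure. -/
abbrev Plane : Type := EuclideanSpace ℝ (Fin 2)

/-- `L²(A)`. Its inner product is `⟨u, v⟩ = ∫_A u v`. -/
abbrev L2 (A : Set Plane) : Type := Lp ℝ 2 (volume.restrict A)

/-- `[L²(A)]²`, with `‖v‖² = ‖v₁‖² + ‖v₂‖²` and `⟨u, v⟩ = ∑ i, ∫_A uᵢ vᵢ`. -/
abbrev L2Vec (A : Set Plane) : Type := PiLp 2 (fun _ : Fin 2 => L2 A)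

/-- `[L²(A)]^{2×2}` (a matrix field is the pair of its rows), with the Frobenius inner product
`⟨M, N⟩ = ∑ i j, ∫_A Mᵢⱼ Nᵢⱼ`. -/
abbrev L2Mat (A : Set Plane) : Type := PiLp 2 (fun _ : Fin 2 => L2Vec A)

/-- Test functions: smooth functions with compact support contained in `A`. -/
structure IsTestFunction (A : Set Plane) (ψ : Plane → ℝ) : Prop where
  smooth : ContDiff ℝ ∞ ψ
  compact : HasCompactSupport ψ
  support : tsupport ψ ⊆ A

/-- The partial derivative `∂ᵢ ψ`. -/
def partialDeriv (i : Fin 2) (ψ : Plane → ℝ) (x : Plane) : ℝ :=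
  fderiv ℝ ψ x (EuclideanSpace.single i 1)

/-- `d ∈ L²(A)` is the weak divergence of `v ∈ [L²(A)]²` on `A`. -/
def HasWeakDiv (A : Set Plane) (v : L2Vec A) (d : L2 A) : Prop :=
  ∀ ψ : Plane → ℝ, IsTestFunction A ψ →
    ∑ i, ∫ x in A, v i x * partialDeriv i ψ x = -∫ x in A, d x * ψ x

theorem IsTestFunction.integrable {A : Set Plane} {ψ : Plane → ℝ} (hψ : IsTestFunction A ψ)
    (u : L2 A) : Integrable (fun x => u x * ψ x) (volume.restrict A) :=
  (Lp.memLp u).integrable_mul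
    (q := 2) (hψ.smooth.continuous.memLp_of_hasCompactSupport hψ.compact)

theorem IsTestFunction.integrable_partial {A : Set Plane} {ψ : Plane → ℝ}
    (hψ : IsTestFunction A ψ) (u : L2 A) (i : Fin 2) :
    Integrable (fun x => u x * partialDeriv i ψ x) (volume.restrict A) := by
  refine (Lp.memLp u).integrable_mul (q := 2) (Continuous.memLp_of_hasCompactSupport ?_ ?_)
  · exact (hψ.smooth.continuous_fderiv (by simp)).clm_apply continuous_const
  · exact hψ.compact.fderiv_apply (𝕜 := ℝ) _

theorem integral_coe_add_mul {A : Set Plane} {f : Plane → ℝ} (u v : L2 A)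
    (hu : Integrable (fun x => u x * f x) (volume.restrict A))
    (hv : Integrable (fun x => v x * f x) (volume.restrict A)) :
    ∫ x in A, (u + v : L2 A) x * f x = (∫ x in A, u x * f x) + ∫ x in A, v x * f x := by
  rw [← integral_add hu hv]
  refine integral_congr_ae ?_
  filter_upwards [Lp.coeFn_add u v] with x hx
  rw [hx, Pi.add_apply, add_mul]

theorem integral_coe_smul_mul {A : Set Plane} {f : Plane → ℝ} (c : ℝ) (u : L2 A) :
    ∫ x in A, (c • u : L2 A) x * f x = c * ∫ x in A, u x * f x := by
  rw [← integral_const_mul]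
  refine integral_congr_ae ?_
  filter_upwards [Lp.coeFn_smul c u] with x hx
  rw [hx, Pi.smul_apply, smul_eq_mul, mul_assoc]

theorem HasWeakDiv.add {A : Set Plane} {u v : L2Vec A} {d e : L2 A}
    (hu : HasWeakDiv A u d) (hv : HasWeakDiv A v e) : HasWeakDiv A (u + v) (d + e) := by
  intro ψ hψ
  have h : ∀ i, ∫ x in A, (u + v) i x * partialDeriv i ψ x
      = (∫ x in A, u i x * partialDeriv i ψ x) + ∫ x in A, v i x * partialDeriv i ψ x :=
    fun i => integral_coe_add_mul (u i) (v i) (hψ.integrable_partial _ i)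
      (hψ.integrable_partial _ i)
  rw [Finset.sum_congr rfl fun i _ => h i, Finset.sum_add_distrib, hu ψ hψ, hv ψ hψ,
    integral_coe_add_mul d e (hψ.integrable d) (hψ.integrable e)]
  ring

theorem HasWeakDiv.smul {A : Set Plane} {u : L2Vec A} {d : L2 A} (c : ℝ)
    (hu : HasWeakDiv A u d) : HasWeakDiv A (c • u) (c • d) := by
  intro ψ hψ
  have h : ∀ i, ∫ x in A, (c • u) i x * partialDeriv i ψ x
      = c * ∫ x in A, u i x * partialDeriv i ψ x :=
    fun i => integral_coe_smul_mul c (u i)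
  rw [Finset.sum_congr rfl fun i _ => h i, ← Finset.mul_sum, hu ψ hψ, integral_coe_smul_mul]
  ring

theorem HasWeakDiv.zero (A : Set Plane) : HasWeakDiv A 0 0 := by
  have h : ∀ (f : Plane → ℝ), ∫ x in A, (0 : L2 A) x * f x = 0 := fun f => by
    simpa using integral_coe_smul_mul (f := f) 0 (0 : L2 A)
  intro ψ _
  have h' : ∀ i, ∫ x in A, (0 : L2Vec A) i x * partialDeriv i ψ x = 0 := fun i => h _
  rw [Finset.sum_congr rfl fun i _ => h' i, h]
  simp

/-- On an open set the weak divergence is unique. -/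
theorem HasWeakDiv.unique {A : Set Plane} (hA : IsOpen A) {v : L2Vec A} {d e : L2 A}
    (hd : HasWeakDiv A v d) (he : HasWeakDiv A v e) : d = e := by
  have key : ∀ᵐ x ∂(volume : Measure Plane), x ∈ A → d x - e x = 0 := by
    refine hA.ae_eq_zero_of_integral_contDiff_smul_eq_zero (f := fun x => d x - e x) ?_ ?_
    · have h : LocallyIntegrable (fun x => d x - e x) (volume.restrict A) :=
        ((Lp.memLp d).sub (Lp.memLp e)).locallyIntegrable (by norm_num)
      exact (locallyIntegrableOn_of_locallyIntegrable_restrict h)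
    · intro ψ h1 h2 h3
      have hψ : IsTestFunction A ψ := ⟨h1, h2, h3⟩
      have h0 : ∫ x in A, d x * ψ x = ∫ x in A, e x * ψ x := by
        have := (hd ψ hψ).symm.trans (he ψ hψ)
        linarith
      have h4 : ∫ x in A, ψ x • (d x - e x) = ∫ x, ψ x • (d x - e x) :=
        setIntegral_eq_integral_of_forall_compl_eq_zero fun x hx => by
          have : ψ x = 0 := image_eq_zero_of_notMem_tsupport fun hx' => hx (h3 hx')
          simp [this]
      rw [← h4]
      have h5 : ∀ x, ψ x • (d x - e x) = d x * ψ x - e x * ψ x := fun x => by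
        rw [smul_eq_mul]; ring
      simp_rw [h5]
      rw [integral_sub (hψ.integrable d) (hψ.integrable e), h0, sub_self]
  refine Lp.ext ((ae_restrict_iff' hA.measurableSet).2 ?_)
  filter_upwards [key] with x hx hxA
  exact sub_eq_zero.1 (hx hxA)

/-- `H(div, A)`: the fields in `[L²(A)]²` whose weak divergence lies in `L²(A)`. -/
def HDiv (A : Set Plane) : Submodule ℝ (L2Vec A) where
  carrier := {v | ∃ d : L2 A, HasWeakDiv A v d}
  add_mem' := by
    rintro u v ⟨d, hd⟩ ⟨e, he⟩
    exact ⟨d + e, hd.add he⟩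
  zero_mem' := ⟨0, HasWeakDiv.zero A⟩
  smul_mem' := by
    rintro c u ⟨d, hd⟩
    exact ⟨c • d, hd.smul c⟩

/-- The divergence `div : H(div, A) → L²(A)`. -/
def weakDiv {A : Set Plane} (v : HDiv A) : L2 A := v.2.choose

theorem hasWeakDiv_weakDiv {A : Set Plane} (v : HDiv A) : HasWeakDiv A v (weakDiv v) :=
  v.2.choose_spec

/-- `H(sym, Div, A)`: symmetric matrix fields whose rows belong to `H(div, A)`. -/
def HSymDiv (A : Set Plane) : Submodule ℝ (L2Mat A) where
  carrier := {M | (∀ i, M i ∈ HDiv A) ∧ ∀ i j, M i j = M j i}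
  add_mem' := by
    rintro M N ⟨hM, hM'⟩ ⟨hN, hN'⟩
    refine ⟨fun i => (HDiv A).add_mem (hM i) (hN i), fun i j => ?_⟩
    simp only [PiLp.add_apply]
    rw [hM' i j, hN' i j]
  zero_mem' := ⟨fun _ => (HDiv A).zero_mem, fun _ _ => rfl⟩
  smul_mem' := by
    rintro c M ⟨hM, hM'⟩
    refine ⟨fun i => (HDiv A).smul_mem c (hM i), fun i j => ?_⟩
    simp only [PiLp.smul_apply]
    rw [hM' i j]

/-- The row-wise divergence `Div : H(sym, Div, A) → [L²(A)]²`. -/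
def rowDiv {A : Set Plane} (M : HSymDiv A) : L2Vec A :=
  WithLp.toLp 2 fun i => weakDiv ⟨(M : L2Mat A) i, M.2.1 i⟩

/-- The compliance tensor `𝔸 M = (12 / E) ((1 + ν) M - ν (tr M) 𝟙)`. -/
def compliance {A : Set Plane} (E ν : ℝ) (M : L2Mat A) : L2Mat A :=
  WithLp.toLp 2 fun i => WithLp.toLp 2 fun j =>
    (12 / E) • ((1 + ν) • M i j - ν • (if i = j then ∑ k, M k k else 0))

/-- `Y(A) = L²(A) × [L²(A)]²`, with `‖(w, φ)‖² = ‖w‖² + ‖φ‖²`. -/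
abbrev YSpace (A : Set Plane) : Type := WithLp 2 (L2 A × L2Vec A)

/-- `Z(A) = H(sym, Div, A) × H(div, A)`. -/
abbrev ZSpace (A : Set Plane) : Type := HSymDiv A × HDiv A

/-- The norm `‖(M, q)‖_{Z_t}`,
`‖(M, q)‖² = ‖M‖² + ‖Div M - q‖² + t² ‖q‖² + ‖div q‖²`. -/
def normZt {A : Set Plane} (t : ℝ) (z : ZSpace A) : ℝ :=
  √(‖z.1‖ ^ 2 + ‖rowDiv z.1 - z.2‖ ^ 2 + t ^ 2 * ‖z.2‖ ^ 2 + ‖weakDiv z.2‖ ^ 2)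

/-- The natural norm of `Z(A)`,
`‖(M, q)‖² = ‖M‖² + ‖Div M‖² + ‖q‖² + ‖div q‖²`. -/
def normZ {A : Set Plane} (z : ZSpace A) : ℝ :=
  √(‖z.1‖ ^ 2 + ‖rowDiv z.1‖ ^ 2 + ‖z.2‖ ^ 2 + ‖weakDiv z.2‖ ^ 2)

/-- The element of the dual space `Y(A)'` given by `g`, namely `(δw, δφ) ↦ ∫_A δw g`. -/
def load {A : Set Plane} (g : L2 A) : StrongDual ℝ (YSpace A) :=
  (innerSL ℝ g).comp (WithLp.fstL 2 ℝ (L2 A) (L2Vec A))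

/-- `((w, φ), (M, q))` solves the four-field variational problem with thickness `t`, elastic
constants `E`, `ν`, shear stiffness `κ` (the product of the shear correction factor and the
shear modulus) and load `g`. -/
def IsSolution {A : Set Plane} (E ν κ t : ℝ) (g : L2 A) (y : YSpace A) (z : ZSpace A) : Prop :=
  (∀ (δM : HSymDiv A) (δq : HDiv A),
    inner ℝ (δM : L2Mat A) (compliance E ν (z.1 : L2Mat A))
      + t ^ 2 / κ * inner ℝ (δq : L2Vec A) (z.2 : L2Vec A)
      + inner ℝ (rowDiv δM) y.snd - inner ℝ (weakDiv δq) y.fst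
      - inner ℝ (δq : L2Vec A) y.snd = 0) ∧
  (∀ δ : YSpace A,
    inner ℝ δ.snd (rowDiv z.1) - inner ℝ δ.fst (weakDiv z.2)
      - inner ℝ δ.snd (z.2 : L2Vec A) = -load g δ)

/-- Well-posedness of the four-field problem in `X(A) = Y(A) × Z(A)` for fixed parameters: for
every load there is exactly one solution, and it depends continuously on the load. -/
def WellPosed (A : Set Plane) (E ν κ t : ℝ) : Prop :=
  (∀ g : L2 A, ∃! x : YSpace A × ZSpace A, IsSolution E ν κ t g x.1 x.2) ∧
  ∃ C : ℝ, 0 < C ∧ ∀ (g : L2 A) (y : YSpace A) (z : ZSpace A),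
    IsSolution E ν κ t g y z → ‖y‖ + normZ z ≤ C * ‖load g‖

end

end Plate

/-!
The four-field problem is a saddle point problem. The stresses `(M, q)` carry the energy
`∫ ⟨M, 𝔸 M⟩ + (t ^ 2 / κ) |q| ^ 2`, the equilibrium operator `B (M, q) = (-div q, Div M - q)` is
prescribed, and `(w, φ)` is the multiplier (`Plate.isSolution_iff`).

In the variables `(M, t q)` the energy form no longer involves `t`, and it is coercive in the `L²`
norm on all stresses, because `(tr M) ^ 2 ≤ 2 |M| ^ 2` in the plane
(`Plate.exists_energyForm_coercive`). For a solution, `Div M = q` and `div q = g`, so that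
`‖(M, q)‖_{Z_t} ^ 2 = ‖(M, t q)‖ ^ 2 + ‖g‖ ^ 2`: the weak norm of the energy suffices for the
robust estimate.

What remains is the inf-sup condition, that is, a right inverse of `B` that is bounded in `L²`
(`Plate.exists_equilibrium_eq`). Neither regularity of the boundary nor Korn's inequality enters:
every `f ∈ L²(A)` on a bounded open set has a weak antiderivative in direction `xᵢ` bounded by
`f`, which is dual to the inequality `‖ψ‖ ≤ 2 R ‖∂ᵢ ψ‖` for test functions. A field with a single
nonzero component then solves `div q = -w`, and a diagonal, hence symmetric, matrix field solves
`Div M = φ + q`. The norm of `(M, t q)` is bounded uniformly for `t ≤ 1`.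

The abstract theory is `Plate.saddlePoint_estimate`, with constants depending only on the
coercivity, the bound of the form and the inf-sup constant, and `Plate.saddlePoint_exists`, which
uses that the kernel of `B` is closed in `L²`. Uniqueness follows from the estimate for `g = 0`.
-/

namespace Plate

/-! ### Abstract saddle point problems -/

/-- A functional on a vector space `P` that is dominated by `‖D p‖` for a linear map `D` into a
Hilbert space is represented through `D`: it factors through the range of `D`, extends by
Hahn–Banach, and is represented by Riesz. -/
theorem exists_inner_eq_of_le_norm {P H : Type*} [AddCommGroup P] [Module ℝ P]
    [NormedAddCommGroup H] [InnerProductSpace ℝ H] [CompleteSpace H]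
    (D : P →ₗ[ℝ] H) (l : P →ₗ[ℝ] ℝ) {C : ℝ} (hC : 0 ≤ C) (hl : ∀ p, |l p| ≤ C * ‖D p‖) :
    ∃ a : H, ‖a‖ ≤ C ∧ ∀ p, inner ℝ a (D p) = l p := by
  obtain ⟨s, hs⟩ := D.rangeRestrict.exists_rightInverse_of_surjective D.range_rangeRestrict
  have hs' : ∀ u, D (s u) = u := fun u =>
    congrArg Subtype.val (LinearMap.congr_fun hs u)
  let F : StrongDual ℝ (LinearMap.range D) := (l ∘ₗ s).mkContinuous C fun u => by
    have := hl (s u)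
    rw [hs'] at this
    simpa using this
  obtain ⟨G, hG, hGn⟩ := exists_extension_norm_eq _ F
  refine ⟨(InnerProductSpace.toDual ℝ H).symm G, ?_, fun p => ?_⟩
  · rw [LinearIsometryEquiv.norm_map, hGn]
    exact LinearMap.mkContinuous_norm_le _ hC _
  · rw [InnerProductSpace.toDual_symm_apply]
    have h1 : G (D p) = l (s (D.rangeRestrict p)) := hG (D.rangeRestrict p)
    -- `l` does not depend on the chosen preimage: it vanishes on the kernel of `D`
    have h2 := hl (s (D.rangeRestrict p) - p)
    rw [map_sub, map_sub, hs', LinearMap.codRestrict_apply, sub_self, norm_zero, mul_zero] at h2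
    rw [h1]
    exact sub_eq_zero.1 (abs_nonpos_iff.1 h2)

section SaddlePoint

variable {Z H Y : Type*} [AddCommGroup Z] [Module ℝ Z]
  [NormedAddCommGroup H] [InnerProductSpace ℝ H]
  [NormedAddCommGroup Y] [InnerProductSpace ℝ Y]
  {ι : Z →ₗ[ℝ] H} {B : Z →ₗ[ℝ] Y} {a : H →L[ℝ] H →L[ℝ] ℝ} {α C : ℝ}

/-- A priori estimate for a saddle point problem. Testing with `z` itself bounds `‖ι z‖ ^ 2` by
`‖f‖ ‖y‖`; testing with a bounded preimage of `y` under `B` bounds `‖y‖` by `‖ι z‖`. -/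
theorem saddlePoint_estimate (hα : 0 < α) (hC : 0 ≤ C) (ha : ∀ u, α * ‖u‖ ^ 2 ≤ a u u)
    (hB : ∀ y, ∃ δ, B δ = y ∧ ‖ι δ‖ ≤ C * ‖y‖) {f y : Y} {z : Z}
    (h1 : ∀ δ, a (ι z) (ι δ) + inner ℝ (B δ) y = 0) (h2 : B z = f) :
    ‖ι z‖ ≤ ‖a‖ * C / α * ‖f‖ ∧ ‖y‖ ≤ ‖a‖ * C * ‖ι z‖ := by
  have hy : ‖y‖ ≤ ‖a‖ * C * ‖ι z‖ := by
    obtain ⟨δ, hδ, hδn⟩ := hB y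
    have h := h1 δ
    rw [hδ, real_inner_self_eq_norm_sq] at h
    have h3 : ‖y‖ ^ 2 ≤ ‖a‖ * ‖ι z‖ * ‖ι δ‖ := by
      have := (neg_le_abs _).trans (a.le_opNorm₂ (ι z) (ι δ))
      linarith
    rcases (norm_nonneg y).eq_or_lt with h0 | h0
    · rw [← h0]; positivity
    · have h4 : ‖a‖ * ‖ι z‖ * ‖ι δ‖ ≤ ‖a‖ * ‖ι z‖ * (C * ‖y‖) := by gcongr
      nlinarith
  refine ⟨?_, hy⟩
  have h := h1 z
  rw [h2] at h
  have h3 : α * ‖ι z‖ ^ 2 ≤ ‖f‖ * (‖a‖ * C * ‖ι z‖) := by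
    have h4 := (neg_le_abs _).trans (abs_real_inner_le_norm f y)
    have h5 := mul_le_mul_of_nonneg_left hy (norm_nonneg f)
    linarith [ha (ι z)]
  rw [div_mul_eq_mul_div, le_div_iff₀ hα]
  rcases (norm_nonneg (ι z)).eq_or_lt with h0 | h0
  · rw [← h0, zero_mul]; positivity
  · nlinarith

/-- Solvability of a saddle point problem: the Lax–Milgram theorem on `ker B` corrects a
particular preimage of `f`, and the multiplier `y` represents the residual functional, which
vanishes on `ker B`. -/
theorem saddlePoint_exists [CompleteSpace H] [CompleteSpace Y]
    (hα : 0 < α) (hC : 0 ≤ C) (ha : ∀ u, α * ‖u‖ ^ 2 ≤ a u u)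
    (hB : ∀ y, ∃ δ, B δ = y ∧ ‖ι δ‖ ≤ C * ‖y‖)
    (hK : IsClosed (((LinearMap.ker B).map ι : Submodule ℝ H) : Set H)) (f : Y) :
    ∃ (y : Y) (z : Z), (∀ δ, a (ι z) (ι δ) + inner ℝ (B δ) y = 0) ∧ B z = f := by
  obtain ⟨z₀, hz₀, -⟩ := hB f
  set K : Submodule ℝ H := (LinearMap.ker B).map ι with hKdef
  have : CompleteSpace K := hK.completeSpace_coe
  let b : K →L[ℝ] K →L[ℝ] ℝ := a.bilinearComp K.subtypeL K.subtypeL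
  have hb : IsCoercive b := ⟨α, hα, fun u => by
    have := ha u
    rw [pow_two, ← mul_assoc] at this
    simpa [b] using this⟩
  let r : StrongDual ℝ K := -((a (ι z₀)).comp K.subtypeL)
  let u : K := hb.continuousLinearEquivOfBilin.symm ((InnerProductSpace.toDual ℝ K).symm r)
  have hu : ∀ w : K, a u w = -a (ι z₀) w := fun w => by
    have h := hb.continuousLinearEquivOfBilin_apply u w
    rw [ContinuousLinearEquiv.apply_symm_apply, InnerProductSpace.toDual_symm_apply] at h
    exact h.symm
  obtain ⟨k, hk, hku⟩ := u.2
  have hker : ∀ δ ∈ LinearMap.ker B, a (ι (z₀ + k)) (ι δ) = 0 := fun δ hδ => by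
    have h := hu ⟨ι δ, δ, hδ, rfl⟩
    rw [← hku] at h
    rw [map_add, map_add, add_apply, h, add_neg_cancel]
  -- the residual of the first equation, to be represented by the multiplier
  let l : Z →ₗ[ℝ] ℝ := -((a (ι (z₀ + k)) : H →ₗ[ℝ] ℝ) ∘ₗ ι)
  have hl : ∀ δ, |l δ| ≤ ‖a‖ * ‖ι (z₀ + k)‖ * C * ‖B δ‖ := fun δ => by
    obtain ⟨δ', hδ', hn⟩ := hB (B δ)
    -- the residual only depends on `B δ`, so a bounded preimage may replace `δ`
    have h0 := hker (δ - δ') (by rw [LinearMap.mem_ker, map_sub, hδ', sub_self])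
    rw [map_sub, map_sub, sub_eq_zero] at h0
    have h1 : |l δ| = ‖a (ι (z₀ + k)) (ι δ')‖ := by
      rw [← h0, Real.norm_eq_abs, ← abs_neg]
      simp [l]
    rw [h1, mul_assoc _ C]
    exact (a.le_opNorm₂ _ _).trans (by gcongr)
  obtain ⟨y, -, hy⟩ := exists_inner_eq_of_le_norm B l (by positivity) hl
  refine ⟨y, z₀ + k, fun δ => ?_, by rw [map_add, hz₀, LinearMap.mem_ker.1 hk, add_zero]⟩
  rw [real_inner_comm, hy δ]
  exact add_neg_cancel _

end SaddlePoint

/-! ### Weak antiderivatives of square-integrable functions -/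

theorem IsTestFunction.memLp {A : Set Plane} {ψ : Plane → ℝ} (hψ : IsTestFunction A ψ) :
    MemLp ψ 2 (volume.restrict A) :=
  hψ.smooth.continuous.memLp_of_hasCompactSupport hψ.compact

theorem IsTestFunction.continuous_partialDeriv {A : Set Plane} {ψ : Plane → ℝ}
    (hψ : IsTestFunction A ψ) (i : Fin 2) : Continuous (partialDeriv i ψ) :=
  (hψ.smooth.continuous_fderiv (by simp)).clm_apply continuous_const

theorem IsTestFunction.memLp_partialDeriv {A : Set Plane} {ψ : Plane → ℝ}
    (hψ : IsTestFunction A ψ) (i : Fin 2) : MemLp (partialDeriv i ψ) 2 (volume.restrict A) :=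
  (hψ.continuous_partialDeriv i).memLp_of_hasCompactSupport (hψ.compact.fderiv_apply (𝕜 := ℝ) _)

theorem IsTestFunction.differentiable {A : Set Plane} {ψ : Plane → ℝ}
    (hψ : IsTestFunction A ψ) : Differentiable ℝ ψ :=
  hψ.smooth.differentiable (by simp)

/-- The test functions on `A`, as a vector space. -/
def testFunctions (A : Set Plane) : Submodule ℝ (Plane → ℝ) where
  carrier := {ψ | IsTestFunction A ψ}
  add_mem' {ψ χ} hψ hχ := ⟨hψ.smooth.add hχ.smooth, hψ.compact.add hχ.compact,
    (tsupport_add ψ χ).trans (Set.union_subset hψ.support hχ.support)⟩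
  zero_mem' := ⟨contDiff_const, HasCompactSupport.zero, by
    rw [tsupport_eq_empty_iff.2 rfl]; exact Set.empty_subset _⟩
  smul_mem' c ψ hψ := ⟨contDiff_const.smul hψ.smooth, hψ.compact.smul_left (f := fun _ => c),
    (tsupport_smul_subset_right (fun _ => c) ψ).trans hψ.support⟩

/-- The class in `L²(A)` of a test function. -/
noncomputable def testToL2 (A : Set Plane) : testFunctions A →ₗ[ℝ] L2 A where
  toFun ψ := ψ.2.memLp.toLp _
  map_add' ψ χ := MemLp.toLp_add ψ.2.memLp χ.2.memLp
  map_smul' c ψ := MemLp.toLp_const_smul c ψ.2.memLp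

/-- The class in `L²(A)` of the partial derivative of a test function. -/
noncomputable def testDeriv (A : Set Plane) (i : Fin 2) : testFunctions A →ₗ[ℝ] L2 A where
  toFun ψ := (ψ.2.memLp_partialDeriv i).toLp _
  map_add' ψ χ := by
    rw [← MemLp.toLp_add]
    congr 1
    funext x
    simp only [partialDeriv, Submodule.coe_add, Pi.add_apply]
    rw [fderiv_add ψ.2.differentiable.differentiableAt χ.2.differentiable.differentiableAt]
    rfl
  map_smul' c ψ := by
    rw [RingHom.id_apply, ← MemLp.toLp_const_smul]
    congr 1
    funext x
    simp only [partialDeriv, Submodule.coe_smul, Pi.smul_apply]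
    rw [fderiv_const_smul ψ.2.differentiable.differentiableAt]
    rfl

theorem inner_testToL2 {A : Set Plane} (u : L2 A) (ψ : testFunctions A) :
    inner ℝ u (testToL2 A ψ) = ∫ x in A, u x * (ψ : Plane → ℝ) x := by
  rw [L2.inner_def]
  refine integral_congr_ae ?_
  filter_upwards [ψ.2.memLp.coeFn_toLp] with x hx
  have : (testToL2 A ψ) x = (ψ : Plane → ℝ) x := hx
  rw [this]
  simp [mul_comm]

theorem inner_testDeriv {A : Set Plane} (u : L2 A) (i : Fin 2) (ψ : testFunctions A) :
    inner ℝ u (testDeriv A i ψ) = ∫ x in A, u x * partialDeriv i ψ x := by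
  rw [L2.inner_def]
  refine integral_congr_ae ?_
  filter_upwards [(ψ.2.memLp_partialDeriv i).coeFn_toLp] with x hx
  have : (testDeriv A i ψ) x = partialDeriv i ψ x := hx
  rw [this]
  simp [mul_comm]

theorem hasWeakDiv_iff {A : Set Plane} {v : L2Vec A} {d : L2 A} :
    HasWeakDiv A v d ↔ ∀ ψ : testFunctions A,
      ∑ i, inner ℝ (v i) (testDeriv A i ψ) = -inner ℝ d (testToL2 A ψ) := by
  simp only [inner_testDeriv, inner_testToL2]
  exact ⟨fun h ψ => h ψ ψ.2, fun h ψ hψ => h ⟨ψ, hψ⟩⟩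

/-- One-directional Poincaré inequality: integrate `ψ ^ 2 * ∂ᵢ xᵢ` by parts. -/
theorem norm_testToL2_le {A : Set Plane} {R : ℝ} (hR : ∀ x ∈ A, ‖x‖ ≤ R)
    (hA : MeasurableSet A) (i : Fin 2) (ψ : testFunctions A) :
    ‖testToL2 A ψ‖ ≤ 2 * |R| * ‖testDeriv A i ψ‖ := by
  obtain ⟨ψ, hψ⟩ := ψ
  set X : Plane →L[ℝ] ℝ := EuclideanSpace.proj i with hX
  have hcd : Continuous fun x => X x * partialDeriv i ψ x :=
    X.continuous.mul (hψ.continuous_partialDeriv i)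
  have hdsupp : HasCompactSupport (partialDeriv i ψ) := hψ.compact.fderiv_apply (𝕜 := ℝ) _
  have hmem : MemLp (fun x => X x * partialDeriv i ψ x) 2 (volume.restrict A) :=
    hcd.memLp_of_hasCompactSupport hdsupp.mul_left
  set D := testDeriv A i ⟨ψ, hψ⟩ with hD
  set J := testToL2 A ⟨ψ, hψ⟩ with hJ
  have hn : ‖hmem.toLp _‖ ≤ |R| * ‖D‖ := by
    refine Lp.norm_le_mul_norm_of_ae_le_mul ?_
    filter_upwards [hmem.coeFn_toLp, (hψ.memLp_partialDeriv i).coeFn_toLp,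
      ae_restrict_mem hA] with x h1 h2 h3
    have h4 : D x = partialDeriv i ψ x := h2
    rw [h1, h4, norm_mul]
    gcongr
    exact (PiLp.norm_apply_le x i).trans ((hR x h3).trans (le_abs_self R))
  have hfd : ∀ x, fderiv ℝ (fun x => ψ x ^ 2) x (EuclideanSpace.single i 1)
      = 2 * ψ x * partialDeriv i ψ x := fun x => by
    rw [fderiv_fun_pow 2 hψ.differentiable.differentiableAt]
    simp [partialDeriv]
  have hparts : ∫ x, X x * (2 * ψ x * partialDeriv i ψ x) = -∫ x, ψ x ^ 2 := by
    have hψc := hψ.smooth.continuous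
    have hdc := hψ.continuous_partialDeriv i
    have hs : HasCompactSupport fun x => ψ x ^ 2 := by
      simp only [pow_two]; exact hψ.compact.mul_left
    have h := integral_mul_fderiv_eq_neg_fderiv_mul_of_integrable (μ := (volume : Measure Plane))
      (f := X) (g := fun x => ψ x ^ 2) (v := EuclideanSpace.single i 1) ?_ ?_ ?_
      (fun x _ => X.differentiableAt) (fun x _ => (hψ.differentiable x).pow 2)
    · have hX1 : X (EuclideanSpace.single i 1) = 1 := by simp [hX]
      simpa only [hfd, ContinuousLinearMap.fderiv, hX1, one_mul] using h
    · exact Continuous.integrable_of_hasCompactSupport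
        (by simp only [ContinuousLinearMap.fderiv]; fun_prop) hs.mul_left
    · simp only [hfd]
      exact Continuous.integrable_of_hasCompactSupport (by fun_prop)
        (hdsupp.mul_left.mul_left)
    · exact Continuous.integrable_of_hasCompactSupport (by fun_prop) hs.mul_left
  have hout : ∀ x, x ∉ A → ψ x = 0 := fun x hx =>
    image_eq_zero_of_notMem_tsupport fun h => hx (hψ.support h)
  have hsq : ‖J‖ ^ 2 = -(2 * inner ℝ J (hmem.toLp _)) := by
    rw [← real_inner_self_eq_norm_sq, hJ, inner_testToL2, L2.inner_def, ← integral_const_mul]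
    have e1 : ∫ x in A, (J : Plane → ℝ) x * ψ x = ∫ x, ψ x ^ 2 := by
      refine (integral_congr_ae ?_).trans
        (setIntegral_eq_integral_of_forall_compl_eq_zero fun x hx => by rw [hout x hx]; simp)
      filter_upwards [hψ.memLp.coeFn_toLp] with x h1
      have h2 : J x = ψ x := h1
      rw [h2, pow_two]
    have e2 : ∫ x in A, 2 * inner ℝ ((J : Plane → ℝ) x) ((hmem.toLp _ : L2 A) x)
        = ∫ x, X x * (2 * ψ x * partialDeriv i ψ x) := by
      refine (integral_congr_ae ?_).trans
        (setIntegral_eq_integral_of_forall_compl_eq_zero fun x hx => by rw [hout x hx]; simp)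
      filter_upwards [hψ.memLp.coeFn_toLp, hmem.coeFn_toLp] with x h1 h2
      have h3 : J x = ψ x := h1
      rw [h3, h2]
      simp only [RCLike.inner_apply, conj_trivial]
      ring
    refine e1.trans ?_
    rw [← neg_eq_iff_eq_neg.2 hparts]
    exact congrArg Neg.neg e2.symm
  have h1 := (neg_le_abs _).trans (abs_real_inner_le_norm J (hmem.toLp _))
  have h2 := mul_le_mul_of_nonneg_left hn (norm_nonneg J)
  rcases (norm_nonneg J).eq_or_lt with h0 | h0
  · rw [← h0]; positivity
  · nlinarith

/-- Every `f ∈ L²(A)` has, in each coordinate direction, a weak antiderivative bounded by `f`: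
the field with this antiderivative as its only component has divergence `f`. -/
theorem exists_hasWeakDiv_single {A : Set Plane} {R : ℝ} (hR : ∀ x ∈ A, ‖x‖ ≤ R)
    (hA : MeasurableSet A) (i : Fin 2) (f : L2 A) :
    ∃ u : L2 A, ‖u‖ ≤ 2 * |R| * ‖f‖ ∧
      HasWeakDiv A (PiLp.single 2 i u) f := by
  obtain ⟨u, hu, hui⟩ := exists_inner_eq_of_le_norm (testDeriv A i)
    (-((innerSL ℝ f : L2 A →ₗ[ℝ] ℝ) ∘ₗ testToL2 A)) (C := 2 * |R| * ‖f‖) (by positivity)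
    fun ψ => by
      have h1 := abs_real_inner_le_norm f (testToL2 A ψ)
      have h2 := mul_le_mul_of_nonneg_left (norm_testToL2_le hR hA i ψ) (norm_nonneg f)
      have h3 : |(-((innerSL ℝ f : L2 A →ₗ[ℝ] ℝ) ∘ₗ testToL2 A)) ψ|
          = |inner ℝ f (testToL2 A ψ)| := by simp
      rw [h3]
      linarith
  refine ⟨u, hu, hasWeakDiv_iff.2 fun ψ => ?_⟩
  have h := hui ψ
  rw [Finset.sum_eq_single i (fun j _ hj => by simp [hj]) (by simp)]
  simpa using h

theorem isClosed_setOf_hasWeakDiv (A : Set Plane) :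
    IsClosed {p : L2Vec A × L2 A | HasWeakDiv A p.1 p.2} := by
  simp only [hasWeakDiv_iff, Set.ofPred_forall]
  exact isClosed_iInter fun ψ => isClosed_eq (by fun_prop) (by fun_prop)

/-! ### The plate problem as a saddle point problem -/

/-- The space `[L²(A)]^{2×2} × [L²(A)]²` in which the energy of the stresses is measured. -/
abbrev StressSpace (A : Set Plane) : Type := WithLp 2 (L2Mat A × L2Vec A)

theorem weakDiv_eq {A : Set Plane} (hA : IsOpen A) {v : HDiv A} {d : L2 A}
    (h : HasWeakDiv A v d) : weakDiv v = d :=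
  (hasWeakDiv_weakDiv v).unique hA h

theorem rowDiv_eq {A : Set Plane} (hA : IsOpen A) {M : HSymDiv A} {f : L2Vec A}
    (h : ∀ i, HasWeakDiv A ((M : L2Mat A) i) (f i)) : rowDiv M = f :=
  PiLp.ext fun i => weakDiv_eq hA (v := ⟨(M : L2Mat A) i, M.2.1 i⟩) (h i)

theorem hasWeakDiv_rowDiv {A : Set Plane} (M : HSymDiv A) (i : Fin 2) :
    HasWeakDiv A ((M : L2Mat A) i) (rowDiv M i) :=
  hasWeakDiv_weakDiv ⟨(M : L2Mat A) i, M.2.1 i⟩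

/-- The equilibrium operator `(M, q) ↦ (-div q, Div M - q)`. -/
noncomputable def equilibrium {A : Set Plane} (hA : IsOpen A) : ZSpace A →ₗ[ℝ] YSpace A where
  toFun z := WithLp.toLp 2 (-weakDiv z.2, rowDiv z.1 - z.2)
  map_add' z z' := by
    have h1 : weakDiv (z.2 + z'.2) = weakDiv z.2 + weakDiv z'.2 :=
      weakDiv_eq hA ((hasWeakDiv_weakDiv z.2).add (hasWeakDiv_weakDiv z'.2))
    have h2 : rowDiv (z.1 + z'.1) = rowDiv z.1 + rowDiv z'.1 :=
      rowDiv_eq hA fun i => (hasWeakDiv_rowDiv z.1 i).add (hasWeakDiv_rowDiv z'.1 i)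
    refine WithLp.ofLp_injective 2 (Prod.ext ?_ ?_)
    · exact (congrArg Neg.neg h1).trans (neg_add _ _)
    · exact (congrArg (· - ((z.2 : L2Vec A) + z'.2)) h2).trans (add_sub_add_comm _ _ _ _)
  map_smul' c z := by
    have h1 : weakDiv (c • z.2) = c • weakDiv z.2 :=
      weakDiv_eq hA ((hasWeakDiv_weakDiv z.2).smul c)
    have h2 : rowDiv (c • z.1) = c • rowDiv z.1 :=
      rowDiv_eq hA fun i => (hasWeakDiv_rowDiv z.1 i).smul c
    refine WithLp.ofLp_injective 2 (Prod.ext ?_ ?_)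
    · exact (congrArg Neg.neg h1).trans (smul_neg _ _).symm
    · exact (congrArg (· - (c • (z.2 : L2Vec A))) h2).trans (smul_sub _ _ _).symm

@[simp]
theorem equilibrium_fst {A : Set Plane} (hA : IsOpen A) (z : ZSpace A) :
    (equilibrium hA z).fst = -weakDiv z.2 := rfl

@[simp]
theorem equilibrium_snd {A : Set Plane} (hA : IsOpen A) (z : ZSpace A) :
    (equilibrium hA z).snd = rowDiv z.1 - z.2 := rfl

/-- The map `(M, q) ↦ (M, t q)`. Scaling the shear force makes the energy form independent
of `t`. -/
noncomputable def scaledStress (A : Set Plane) (t : ℝ) : ZSpace A →ₗ[ℝ] StressSpace A :=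
  (WithLp.linearEquiv 2 ℝ (L2Mat A × L2Vec A)).symm.toLinearMap ∘ₗ
    (HSymDiv A).subtype.prodMap (t • (HDiv A).subtype)

@[simp]
theorem scaledStress_fst {A : Set Plane} (t : ℝ) (z : ZSpace A) :
    (scaledStress A t z).fst = z.1 := rfl

@[simp]
theorem scaledStress_snd {A : Set Plane} (t : ℝ) (z : ZSpace A) :
    (scaledStress A t z).snd = t • (z.2 : L2Vec A) := rfl

theorem norm_scaledStress_sq {A : Set Plane} (t : ℝ) (z : ZSpace A) :
    ‖scaledStress A t z‖ ^ 2 = ‖z.1‖ ^ 2 + t ^ 2 * ‖z.2‖ ^ 2 := by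
  rw [WithLp.prod_norm_sq_eq_of_L2, scaledStress_fst, scaledStress_snd, norm_smul, mul_pow,
    Real.norm_eq_abs, sq_abs, Submodule.coe_norm, Submodule.coe_norm]

theorem norm_fst_le_norm_scaledStress {A : Set Plane} (t : ℝ) (z : ZSpace A) :
    ‖z.1‖ ≤ ‖scaledStress A t z‖ :=
  WithLp.norm_fst_le _ (scaledStress A t z)

theorem mul_norm_snd_le_norm_scaledStress {A : Set Plane} {t : ℝ} (ht : 0 ≤ t) (z : ZSpace A) :
    t * ‖z.2‖ ≤ ‖scaledStress A t z‖ := by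
  have h : ‖t • (z.2 : L2Vec A)‖ ≤ ‖scaledStress A t z‖ := WithLp.norm_snd_le _ (scaledStress A t z)
  rwa [norm_smul, Real.norm_of_nonneg ht] at h

theorem norm_scaledStress_le {A : Set Plane} {t : ℝ} (ht : 0 ≤ t) (z : ZSpace A) :
    ‖scaledStress A t z‖ ≤ ‖z.1‖ + t * ‖z.2‖ := by
  refine le_of_sq_le_sq ?_ (by positivity)
  rw [norm_scaledStress_sq]
  have : 0 ≤ ‖z.1‖ * (t * ‖z.2‖) := by positivity
  nlinarith

/-- The trace of a matrix field. -/
noncomputable def traceL (A : Set Plane) : L2Mat A →L[ℝ] L2 A :=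
  ∑ i, (PiLp.proj (𝕜 := ℝ) 2 (fun _ : Fin 2 => L2 A) i).comp
    (PiLp.proj (𝕜 := ℝ) 2 (fun _ : Fin 2 => L2Vec A) i)

theorem traceL_apply {A : Set Plane} (M : L2Mat A) : traceL A M = M 0 0 + M 1 1 := by
  simp [traceL, Fin.sum_univ_two]

theorem norm_traceL_sq_le {A : Set Plane} (M : L2Mat A) : ‖traceL A M‖ ^ 2 ≤ 2 * ‖M‖ ^ 2 := by
  rw [traceL_apply]
  have h := norm_add_le (M 0 0) (M 1 1)
  have h2 : ‖M‖ ^ 2 = ‖M 0 0‖ ^ 2 + ‖M 0 1‖ ^ 2 + (‖M 1 0‖ ^ 2 + ‖M 1 1‖ ^ 2) := by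
    simp [PiLp.norm_sq_eq_of_L2, Fin.sum_univ_two]
  rw [h2]
  nlinarith [norm_nonneg (M 0 0 + M 1 1), sq_nonneg (‖M 0 0‖ - ‖M 1 1‖), sq_nonneg ‖M 0 1‖,
    sq_nonneg ‖M 1 0‖]

theorem inner_compliance {A : Set Plane} (E ν : ℝ) (N M : L2Mat A) :
    inner ℝ N (compliance E ν M)
      = 12 / E * ((1 + ν) * inner ℝ M N - ν * inner ℝ (traceL A M) (traceL A N)) := by
  simp only [compliance, PiLp.inner_apply, Fin.sum_univ_two, traceL_apply, inner_smul_right,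
    inner_sub_right, inner_add_right, real_inner_comm (N _ _)]
  simp [inner_add_right]
  ring

/-- The energy form `((M, p), (N, r)) ↦ ∫ ⟨N, 𝔸 M⟩ + κ⁻¹ ⟨r, p⟩`, with the compliance written through
the trace as in `inner_compliance`. -/
noncomputable def energyForm (A : Set Plane) (E ν κ : ℝ) :
    StressSpace A →L[ℝ] StressSpace A →L[ℝ] ℝ :=
  (12 / E) • ((1 + ν) • (innerSL ℝ).bilinearComp (WithLp.fstL 2 ℝ (L2Mat A) (L2Vec A))
        (WithLp.fstL 2 ℝ (L2Mat A) (L2Vec A))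
      - ν • (innerSL ℝ).bilinearComp ((traceL A).comp (WithLp.fstL 2 ℝ (L2Mat A) (L2Vec A)))
        ((traceL A).comp (WithLp.fstL 2 ℝ (L2Mat A) (L2Vec A))))
    + κ⁻¹ • (innerSL ℝ).bilinearComp (WithLp.sndL 2 ℝ (L2Mat A) (L2Vec A))
        (WithLp.sndL 2 ℝ (L2Mat A) (L2Vec A))

theorem energyForm_apply {A : Set Plane} (E ν κ : ℝ) (u v : StressSpace A) :
    energyForm A E ν κ u v = 12 / E * ((1 + ν) * inner ℝ u.fst v.fst
      - ν * inner ℝ (traceL A u.fst) (traceL A v.fst)) + κ⁻¹ * inner ℝ u.snd v.snd := by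
  simp [energyForm]

/-- The energy form is coercive on all stresses. In two dimensions `(tr M) ^ 2 ≤ 2 |M| ^ 2`, so
the eigenvalues of the compliance tensor are at least `12 / E * min (1 - ν) (1 + ν)`. -/
theorem exists_energyForm_coercive (A : Set Plane) {E ν κ : ℝ} (hE : 0 < E) (hν : -1 < ν)
    (hν' : ν < 1) (hκ : 0 < κ) :
    ∃ α : ℝ, 0 < α ∧ ∀ u : StressSpace A, α * ‖u‖ ^ 2 ≤ energyForm A E ν κ u u := by
  refine ⟨min (12 / E * min (1 - ν) (1 + ν)) κ⁻¹, ?_, fun u => ?_⟩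
  · exact lt_min (mul_pos (by positivity) (lt_min (by linarith) (by linarith))) (by positivity)
  rw [energyForm_apply, WithLp.prod_norm_sq_eq_of_L2, mul_add, real_inner_self_eq_norm_sq,
    real_inner_self_eq_norm_sq, real_inner_self_eq_norm_sq]
  have h1 := norm_traceL_sq_le u.fst
  have h2 : min (1 - ν) (1 + ν) * ‖u.fst‖ ^ 2
      ≤ (1 + ν) * ‖u.fst‖ ^ 2 - ν * ‖traceL A u.fst‖ ^ 2 := by
    rcases le_total 0 ν with h | h
    · have := mul_le_mul_of_nonneg_right (min_le_left (1 - ν) (1 + ν)) (sq_nonneg ‖u.fst‖)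
      nlinarith
    · have := mul_le_mul_of_nonneg_right (min_le_right (1 - ν) (1 + ν)) (sq_nonneg ‖u.fst‖)
      nlinarith [sq_nonneg ‖traceL A u.fst‖]
  refine add_le_add ?_ (mul_le_mul_of_nonneg_right (min_le_right _ _) (sq_nonneg _))
  refine (mul_le_mul_of_nonneg_right (min_le_left _ _) (sq_nonneg _)).trans ?_
  rw [mul_assoc]
  exact mul_le_mul_of_nonneg_left h2 (by positivity)

/-- The four-field problem is a saddle point problem for the energy form, constrained by
`(-div q, Div M - q) = (-g, 0)`, with multiplier `(w, φ)`. -/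
theorem isSolution_iff {A : Set Plane} (hA : IsOpen A) {E ν κ t : ℝ} {g : L2 A} {y : YSpace A}
    {z : ZSpace A} :
    IsSolution E ν κ t g y z ↔
      (∀ δ, energyForm A E ν κ (scaledStress A t z) (scaledStress A t δ)
        + inner ℝ (equilibrium hA δ) y = 0) ∧
      equilibrium hA z = WithLp.toLp 2 (-g, 0) := by
  refine and_congr ?_ ?_
  · have h : ∀ δ : ZSpace A, energyForm A E ν κ (scaledStress A t z) (scaledStress A t δ)
        + inner ℝ (equilibrium hA δ) y
        = inner ℝ (δ.1 : L2Mat A) (compliance E ν (z.1 : L2Mat A))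
          + t ^ 2 / κ * inner ℝ (δ.2 : L2Vec A) (z.2 : L2Vec A)
          + inner ℝ (rowDiv δ.1) y.snd - inner ℝ (weakDiv δ.2) y.fst
          - inner ℝ (δ.2 : L2Vec A) y.snd := fun δ => by
      have hi : inner ℝ (equilibrium hA δ) y
          = inner ℝ (equilibrium hA δ).fst y.fst + inner ℝ (equilibrium hA δ).snd y.snd :=
        WithLp.prod_inner_apply _ _
      rw [energyForm_apply, inner_compliance, hi]
      simp only [scaledStress_fst, scaledStress_snd, equilibrium_fst, equilibrium_snd,
        real_inner_smul_left, real_inner_smul_right, inner_neg_left, inner_sub_left,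
        real_inner_comm (z.2 : L2Vec A)]
      ring
    simp only [h, Prod.forall]
  · have h : ∀ δ : YSpace A, inner ℝ δ.snd (rowDiv z.1) - inner ℝ δ.fst (weakDiv z.2)
        - inner ℝ δ.snd (z.2 : L2Vec A) = inner ℝ δ (equilibrium hA z) := fun δ => by
      have hi : inner ℝ δ (equilibrium hA z)
          = inner ℝ δ.fst (equilibrium hA z).fst + inner ℝ δ.snd (equilibrium hA z).snd :=
        WithLp.prod_inner_apply _ _
      rw [hi, equilibrium_fst, equilibrium_snd, inner_neg_right, inner_sub_right]
      ring
    have h' : ∀ δ : YSpace A, -load g δ = inner ℝ δ (WithLp.toLp 2 (-g, (0 : L2Vec A))) :=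
      fun δ => by
        rw [WithLp.prod_inner_apply]
        simp [load, real_inner_comm]
    simp only [h, h']
    exact ⟨fun e => ext_inner_left ℝ e, fun e δ => by rw [e]⟩

theorem norm_le_norm_load {A : Set Plane} (g : L2 A) : ‖g‖ ≤ ‖load g‖ := by
  rcases (norm_nonneg g).eq_or_lt with h0 | h0
  · rw [← h0]; positivity
  have h := (load g).le_opNorm (WithLp.toLp 2 (g, 0))
  have h1 : load g (WithLp.toLp 2 (g, 0)) = ‖g‖ ^ 2 := by
    rw [← real_inner_self_eq_norm_sq]; rfl
  rw [h1, WithLp.norm_toLp_fst, Real.norm_of_nonneg (sq_nonneg _)] at h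
  nlinarith

/-- The inf-sup condition. The equation `div q = -w` is solved by a field with one nonzero
component, and `Div M = φ + q` by a diagonal matrix field, which is symmetric. -/
theorem exists_equilibrium_eq {A : Set Plane} (hA : IsOpen A) (hb : Bornology.IsBounded A) :
    ∃ C : ℝ, 0 ≤ C ∧ ∀ y : YSpace A, ∃ z : ZSpace A,
      equilibrium hA z = y ∧ ‖z.1‖ ≤ C * ‖y‖ ∧ ‖z.2‖ ≤ C * ‖y‖ := by
  obtain ⟨R, hR⟩ := hb.exists_norm_le
  set L := 2 * |R| with hL
  have hL0 : 0 ≤ L := by positivity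
  refine ⟨(1 + L) ^ 2, by positivity, fun y => ?_⟩
  have hy1 : ‖y.fst‖ ≤ ‖y‖ := WithLp.norm_fst_le _ y
  have hy2 : ‖y.snd‖ ≤ ‖y‖ := WithLp.norm_snd_le _ y
  obtain ⟨p, hp, hpd⟩ := exists_hasWeakDiv_single hR hA.measurableSet 0 (-y.fst)
  set q : L2Vec A := PiLp.single 2 0 p with hq
  have hqn : ‖q‖ ≤ L * ‖y‖ := by
    have : ‖q‖ = ‖p‖ := PiLp.norm_single 2 (fun _ : Fin 2 => L2 A) 0 p
    rw [this]
    rw [norm_neg] at hp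
    exact hp.trans (by gcongr)
  choose u hu hud using fun i : Fin 2 =>
    exists_hasWeakDiv_single hR hA.measurableSet i (y.snd i + q i)
  let M : L2Mat A := WithLp.toLp 2 fun i => PiLp.single 2 i (u i)
  have hMn : ‖M‖ ≤ L * ‖y.snd + q‖ := by
    refine le_of_sq_le_sq ?_ (by positivity)
    rw [mul_pow, PiLp.norm_sq_eq_of_L2, PiLp.norm_sq_eq_of_L2, Finset.mul_sum]
    refine Finset.sum_le_sum fun i _ => ?_
    have : ‖M i‖ = ‖u i‖ := PiLp.norm_single 2 (fun _ : Fin 2 => L2 A) i (u i)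
    rw [this, ← mul_pow]
    exact pow_le_pow_left₀ (norm_nonneg _) (hu i) 2
  have hMs : M ∈ HSymDiv A := by
    refine ⟨fun i => ⟨_, hud i⟩, fun i j => ?_⟩
    rcases eq_or_ne i j with h | h
    · rw [h]
    · simp [M, h, h.symm]
  refine ⟨(⟨M, hMs⟩, ⟨q, _, hpd⟩), ?_, ?_, ?_⟩
  · have h1 : weakDiv (⟨q, _, hpd⟩ : HDiv A) = -y.fst := weakDiv_eq hA hpd
    have h2 : rowDiv (⟨M, hMs⟩ : HSymDiv A) = y.snd + q := rowDiv_eq hA hud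
    simp only [equilibrium, LinearMap.coe_mk, AddHom.coe_mk, h1, h2, neg_neg, add_sub_cancel_right]
    rfl
  · refine hMn.trans ?_
    have h1 : ‖y.snd + q‖ ≤ (1 + L) * ‖y‖ := by linarith [norm_add_le y.snd q]
    rw [pow_two, mul_assoc (1 + L)]
    exact mul_le_mul (by linarith) h1 (norm_nonneg _) (by positivity)
  · refine hqn.trans ?_
    gcongr
    nlinarith

/-- Equality of weak divergences is preserved under `L²` limits, so the stresses in equilibrium
with zero load are closed already in `L²`. -/
theorem isClosed_map_ker_equilibrium {A : Set Plane} (hA : IsOpen A) {t : ℝ} (ht : 0 < t) :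
    IsClosed (((LinearMap.ker (equilibrium hA)).map (scaledStress A t) :
      Submodule ℝ (StressSpace A)) : Set (StressSpace A)) := by
  have h : (((LinearMap.ker (equilibrium hA)).map (scaledStress A t) :
      Submodule ℝ (StressSpace A)) : Set (StressSpace A))
      = {u | (∀ i j, u.fst i j = u.fst j i) ∧
          (∀ i, HasWeakDiv A (u.fst i) ((t⁻¹ • u.snd) i)) ∧ HasWeakDiv A (t⁻¹ • u.snd) 0} := by
    ext u
    constructor
    · rintro ⟨z, hz, rfl⟩
      have h1 : weakDiv z.2 = 0 := neg_eq_zero.1 (congrArg WithLp.fst (LinearMap.mem_ker.1 hz))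
      have h2 : rowDiv z.1 = z.2 := sub_eq_zero.1 (congrArg WithLp.snd (LinearMap.mem_ker.1 hz))
      have h3 : t⁻¹ • (scaledStress A t z).snd = (z.2 : L2Vec A) := by
        rw [scaledStress_snd, smul_smul, inv_mul_cancel₀ ht.ne', one_smul]
      refine ⟨z.1.2.2, ?_, ?_⟩
      · rw [h3, ← h2]
        exact hasWeakDiv_rowDiv z.1
      · rw [h3, ← h1]
        exact hasWeakDiv_weakDiv z.2
    · rintro ⟨h1, h2, h3⟩
      refine ⟨(⟨u.fst, fun i => ⟨_, h2 i⟩, h1⟩, ⟨t⁻¹ • u.snd, _, h3⟩), ?_, ?_⟩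
      · rw [SetLike.mem_coe, LinearMap.mem_ker]
        have e1 := weakDiv_eq hA (v := ⟨t⁻¹ • u.snd, _, h3⟩) h3
        have e2 := rowDiv_eq hA (M := ⟨u.fst, fun i => ⟨_, h2 i⟩, h1⟩) h2
        simp only [equilibrium, LinearMap.coe_mk, AddHom.coe_mk, e1, e2, neg_zero, sub_self]
        rfl
      · refine WithLp.ofLp_injective 2 (Prod.ext rfl ?_)
        exact smul_inv_smul₀ ht.ne' u.snd
  rw [h]
  have hfst : Continuous fun u : StressSpace A => u.fst :=
    (WithLp.fstL 2 ℝ (L2Mat A) (L2Vec A)).continuous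
  have hsnd : Continuous fun u : StressSpace A => u.snd :=
    (WithLp.sndL 2 ℝ (L2Mat A) (L2Vec A)).continuous
  refine IsClosed.and ?_ (IsClosed.and ?_ ?_)
  · simp only [Set.ofPred_forall]
    exact isClosed_iInter fun i => isClosed_iInter fun j =>
      isClosed_eq (by fun_prop) (by fun_prop)
  · simp only [Set.ofPred_forall]
    exact isClosed_iInter fun i => (isClosed_setOf_hasWeakDiv A).preimage
      (f := fun u : StressSpace A => (u.fst i, (t⁻¹ • u.snd) i)) (by fun_prop)
  · exact (isClosed_setOf_hasWeakDiv A).preimage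
      (f := fun u : StressSpace A => (t⁻¹ • u.snd, (0 : L2 A))) (by fun_prop)

/-! ### Stability and well-posedness -/

/-- The a priori estimate, with a constant that is uniform for `t` in a bounded interval. -/
theorem exists_stability {A : Set Plane} (hA : IsOpen A) (hb : Bornology.IsBounded A)
    {E ν κ : ℝ} (hE : 0 < E) (hν : -1 < ν) (hν' : ν < 1) (hκ : 0 < κ) {T : ℝ} (hT : 0 ≤ T) :
    ∃ c : ℝ, 0 ≤ c ∧ ∀ t : ℝ, 0 < t → t ≤ T → ∀ (g : L2 A) (y : YSpace A) (z : ZSpace A),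
      IsSolution E ν κ t g y z →
        ‖y‖ ≤ c * ‖load g‖ ∧ ‖scaledStress A t z‖ ≤ c * ‖load g‖ := by
  obtain ⟨C, hC, hCB⟩ := exists_equilibrium_eq hA hb
  obtain ⟨α, hα, hαa⟩ := exists_energyForm_coercive A hE hν hν' hκ
  set K := ‖energyForm A E ν κ‖ * ((1 + T) * C) with hK
  have hK0 : 0 ≤ K := by positivity
  refine ⟨max (K / α) (K * (K / α)), by positivity, fun t ht htT g y z h => ?_⟩
  obtain ⟨h1, h2⟩ := (isSolution_iff hA).1 h
  -- the inf-sup constant after scaling is at most `C + t C`, which is monotone in `t`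
  have hB : ∀ y, ∃ δ, equilibrium hA δ = y ∧ ‖scaledStress A t δ‖ ≤ (1 + T) * C * ‖y‖ :=
    fun y => by
      obtain ⟨δ, hδ, hM, hq⟩ := hCB y
      refine ⟨δ, hδ, (norm_scaledStress_le ht.le δ).trans ?_⟩
      have := mul_le_mul htT hq (norm_nonneg _) hT
      linarith
  obtain ⟨e1, e2⟩ := saddlePoint_estimate hα (by positivity) hαa hB h1 h2
  have hg : ‖(WithLp.toLp 2 (-g, 0) : YSpace A)‖ ≤ ‖load g‖ := by
    rw [WithLp.norm_toLp_fst, norm_neg]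
    exact norm_le_norm_load g
  have e3 : ‖scaledStress A t z‖ ≤ K / α * ‖load g‖ :=
    e1.trans (mul_le_mul_of_nonneg_left hg (by positivity))
  constructor
  · have e4 : ‖y‖ ≤ K * (K / α) * ‖load g‖ := by
      rw [mul_assoc]
      exact e2.trans (mul_le_mul_of_nonneg_left e3 hK0)
    exact e4.trans (mul_le_mul_of_nonneg_right (le_max_right _ _) (norm_nonneg _))
  · exact e3.trans (mul_le_mul_of_nonneg_right (le_max_left _ _) (norm_nonneg _))

theorem IsSolution.weakDiv_eq {A : Set Plane} (hA : IsOpen A) {E ν κ t : ℝ} {g : L2 A}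
    {y : YSpace A} {z : ZSpace A} (h : IsSolution E ν κ t g y z) : weakDiv z.2 = g :=
  neg_injective (congrArg WithLp.fst ((isSolution_iff hA).1 h).2)

theorem IsSolution.rowDiv_eq {A : Set Plane} (hA : IsOpen A) {E ν κ t : ℝ} {g : L2 A}
    {y : YSpace A} {z : ZSpace A} (h : IsSolution E ν κ t g y z) : rowDiv z.1 = z.2 :=
  sub_eq_zero.1 (congrArg WithLp.snd ((isSolution_iff hA).1 h).2)

theorem IsSolution.sub {A : Set Plane} (hA : IsOpen A) {E ν κ t : ℝ} {g g' : L2 A}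
    {y y' : YSpace A} {z z' : ZSpace A} (h : IsSolution E ν κ t g y z)
    (h' : IsSolution E ν κ t g' y' z') : IsSolution E ν κ t (g - g') (y - y') (z - z') := by
  rw [isSolution_iff hA] at *
  refine ⟨fun δ => ?_, ?_⟩
  · have h1 := h.1 δ
    have h2 := h'.1 δ
    rw [map_sub, map_sub, sub_apply, inner_sub_right]
    linarith
  · rw [map_sub, h.2, h'.2]
    refine WithLp.ofLp_injective 2 (Prod.ext ?_ ?_)
    · exact (neg_sub_neg g g').trans (neg_sub g g').symm
    · exact sub_zero _

theorem scaledStress_injective (A : Set Plane) {t : ℝ} (ht : t ≠ 0) :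
    Function.Injective (scaledStress A t) := fun z z' h => by
  refine Prod.ext (Subtype.ext (congrArg WithLp.fst h)) (Subtype.ext ?_)
  exact smul_right_injective _ ht (congrArg WithLp.snd h)

theorem wellPosed {A : Set Plane} (hA : IsOpen A) (hb : Bornology.IsBounded A)
    {E ν κ t : ℝ} (hE : 0 < E) (hν : -1 < ν) (hν' : ν < 1) (hκ : 0 < κ) (ht : 0 < t) :
    WellPosed A E ν κ t := by
  obtain ⟨c, hc, hst⟩ := exists_stability hA hb hE hν hν' hκ ht.le
  refine ⟨fun g => ?_, c + (c + 2 * (c / t) + 1), by positivity, fun g y z h => ?_⟩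
  · obtain ⟨C, hC, hCB⟩ := exists_equilibrium_eq hA hb
    obtain ⟨α, hα, hαa⟩ := exists_energyForm_coercive A hE hν hν' hκ
    obtain ⟨y, z, h⟩ := saddlePoint_exists (C := C + t * C) hα (by positivity) hαa
      (fun y => by
        obtain ⟨δ, hδ, hM, hq⟩ := hCB y
        refine ⟨δ, hδ, (norm_scaledStress_le ht.le δ).trans ?_⟩
        have := mul_le_mul_of_nonneg_left hq ht.le
        linarith)
      (isClosed_map_ker_equilibrium hA ht) (WithLp.toLp 2 (-g, 0))
    have hs := (isSolution_iff hA).2 h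
    refine ⟨(y, z), hs, fun x hx => ?_⟩
    obtain ⟨e1, e2⟩ := hst t ht le_rfl _ _ _ (hx.sub hA hs)
    have h0 : ‖load (g - g)‖ = 0 := by simp [load]
    rw [h0, mul_zero, norm_le_zero_iff] at e1 e2
    refine Prod.ext (sub_eq_zero.1 e1) (scaledStress_injective A ht.ne' ?_)
    rwa [map_sub, sub_eq_zero] at e2
  · obtain ⟨e1, e2⟩ := hst t ht le_rfl g y z h
    have hM : ‖z.1‖ ≤ c * ‖load g‖ := (norm_fst_le_norm_scaledStress t z).trans e2
    -- only `t ‖q‖` is controlled by the energy, whence the factor `1 / t` in the natural norm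
    have hq : ‖z.2‖ ≤ c / t * ‖load g‖ := by
      rw [div_mul_eq_mul_div, le_div_iff₀ ht, mul_comm]
      exact (mul_norm_snd_le_norm_scaledStress ht.le z).trans e2
    have hz : normZ z ≤ ‖z.1‖ + 2 * ‖z.2‖ + ‖load g‖ := by
      rw [normZ, h.weakDiv_eq hA, h.rowDiv_eq hA, ← Submodule.coe_norm z.2]
      refine Real.sqrt_le_iff.2 ⟨by positivity, ?_⟩
      have hg := pow_le_pow_left₀ (norm_nonneg _) (norm_le_norm_load g) 2
      have p1 : 0 ≤ ‖z.1‖ * ‖z.2‖ := by positivity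
      have p2 : 0 ≤ ‖z.1‖ * ‖load g‖ := by positivity
      have p3 : 0 ≤ ‖z.2‖ * ‖load g‖ := by positivity
      nlinarith [sq_nonneg ‖z.2‖]
    linarith

end Plate

theorem mainTheorem1 (A : Set Plate.Plane) (hA_open : IsOpen A) (hA_bdd : Bornology.IsBounded A)
    (hA_contr : ContractibleSpace A) (E ν κ : ℝ) (hE : 0 < E) (hν : -1 < ν) (hν' : ν < 1)
    (hκ : 0 < κ) :
    (∀ t : ℝ, 0 < t → Plate.WellPosed A E ν κ t) ∧
    ∃ c : ℝ, 0 < c ∧ ∀ t : ℝ, 0 < t → t ≤ 1 →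
      ∀ (g : Plate.L2 A) (y : Plate.YSpace A) (z : Plate.ZSpace A),
        Plate.IsSolution E ν κ t g y z →
          ‖y‖ + Plate.normZt t z ≤ c * ‖Plate.load g‖ := by
  refine ⟨fun t ht => Plate.wellPosed hA_open hA_bdd hE hν hν' hκ ht, ?_⟩
  obtain ⟨c, hc, hst⟩ := Plate.exists_stability hA_open hA_bdd hE hν hν' hκ zero_le_one
  refine ⟨c + (c + 1), by positivity, fun t ht ht1 g y z h => ?_⟩
  obtain ⟨e1, e2⟩ := hst t ht ht1 g y z h
  have hz : Plate.normZt t z ≤ ‖Plate.scaledStress A t z‖ + ‖Plate.load g‖ := by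
    rw [Plate.normZt, h.weakDiv_eq hA_open, h.rowDiv_eq hA_open, sub_self, norm_zero]
    refine Real.sqrt_le_iff.2 ⟨by positivity, ?_⟩
    have hg := pow_le_pow_left₀ (norm_nonneg _) (Plate.norm_le_norm_load g) 2
    have hs := Plate.norm_scaledStress_sq t z
    have p : 0 ≤ ‖Plate.scaledStress A t z‖ * ‖Plate.load g‖ := by positivity
    nlinarith
  linarith
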